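/- A complex Hadamard matrix (CHM) of order $n$ is an $n\times n$ complex matrix $A$ all of whose entries have modulus one and which satisfies $AA^{*}=nI$. Two matrices are complex equivalent if one is obtained from the other by permuting rows and columns and multiplying rows and columns by complex numbers of modulus one. A $6\times 6$ CHM $H$ is called $H_2$-reducible if it is complex equivalent to a matrix which, partitioned into nine consecutive $2\times 2$ blocks, has all nine blocks CHMs of order two. Let $N(H)$ denote the number of $2\times 2$ submatrices of $H$ (choices of two rows and two columns) that are CHMs. For every $6\times 6$ $H_2$-reducible complex Hadamard matrix $H$, one has $N(H)=9$, $N(H)=17$, or $N(H)>18$; in particular $N(H)$ is never $10,\dots,16$ or $18$. Moreover, the values $9$ and $17$ are both attained: there exist $H_2$-reducible matrices $H$ with $N(H)=9$ and with $N(H)=17$. -/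

import Mathlib

/-- Complex equivalence of matrices: `K` arises from `H` by permuting rows and columns and
multiplying rows and columns by complex numbers of modulus one. -/
def ComplexEquivalent {n : Type*} (H K : Matrix n n ℂ) : Prop :=
  ∃ (σ τ : Equiv.Perm n) (d e : n → ℂ),
    (∀ i, ‖d i‖ = 1) ∧ (∀ j, ‖e j‖ = 1) ∧ ∀ i j, K i j = d i * H (σ i) (τ j) * e j

/-- The `a`-th pair of consecutive indices in `Fin 6`: `i ↦ 2 * a + i`. -/
def pairIndex (a : Fin 3) (i : Fin 2) : Fin 6 :=
  ⟨2 * a.val + i.val, by omega⟩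

/-- A `6 × 6` complex Hadamard matrix is `H₂`-reducible if it is complex equivalent to a matrix
whose nine consecutive `2 × 2` blocks are all complex Hadamard matrices. Over `ℂ`,
`Matrix.IsHadamard` is the notion of a complex Hadamard matrix: entries of modulus one and
`A * Aᴴ = n • 1`. -/
def IsH2Reducible (H : Matrix (Fin 6) (Fin 6) ℂ) : Prop :=
  H.IsHadamard ∧ ∃ K : Matrix (Fin 6) (Fin 6) ℂ, ComplexEquivalent H K ∧
    ∀ a b : Fin 3, (K.submatrix (pairIndex a) (pairIndex b)).IsHadamard

open Classical in
/-- The number of `2 × 2` complex Hadamard submatrices of a `6 × 6` matrix: the number of choices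
of two rows `i < j` and two columns `k < l` whose submatrix is a complex Hadamard matrix. -/
noncomputable def numHadamardSubmatrices (H : Matrix (Fin 6) (Fin 6) ℂ) : ℕ :=
  (Finset.univ.filter fun q : (Fin 6 × Fin 6) × (Fin 6 × Fin 6) =>
    q.1.1 < q.1.2 ∧ q.2.1 < q.2.2 ∧
      (H.submatrix ![q.1.1, q.1.2] ![q.2.1, q.2.2]).IsHadamard).card

/-! For unimodular entries conjugation is inversion, so the upper bound on possible values can be
argued over any field of characteristic zero, with quotients in place of Hermitian products. A 2 × 2
submatrix is Hadamard exactly when its permanent vanishes, that is, when two entries of the quotient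
of its rows cancel. Call two rows an edge if this happens for some columns. The six quotients and
their inverses both sum to zero, so once two of them cancel all do in pairs (`four_sum_zero`) and
they are ±a, ±b, ±c. An edge thus carries 3 + 2t submatrices, t counting coincidences up to sign
among a, b, c, and N = 3E + 2s with E the number of edges and s the total of the t. The blocks give
E ≥ 3.

An edge between different blocks forces the edge of the partner rows (`exists_antipodal_partner`),
so then E ≥ 5. Without coincidences for rows or columns, either E = 3 and N = 9, or E ≥ 7 and N ≥ 21
(`seven_le_card_rowEdges`). A coincidence for rows yields a column edge outside the blocks, and
conversely. If rows, or columns, have both a coincidence and an outside edge, then E ≥ 5 and s ≥ 1,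
so N is 17 or at least 19. Otherwise, up to transposition, rows have coincidences but no outside
edge and columns have no coincidence; cube roots of unity then force nine column edges, so N ≥ 27
(`antipodal_third`). Explicit matrices attain 9 and 17. -/

/-! ### Cancelling quotients in inverse orthogonal matrices -/

section InverseOrthogonal

variable {F : Type*} [Field F]

/-- A `6 × 6` matrix with nonzero entries whose rows, and whose columns, are pairwise orthogonal
with respect to entrywise quotients. -/
structure IsInverseOrthogonal (H : Matrix (Fin 6) (Fin 6) F) : Prop where
  ne_zero : ∀ i k, H i k ≠ 0
  row : ∀ i j, i ≠ j → ∑ k, H i k / H j k = 0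
  col : ∀ k l, k ≠ l → ∑ i, H i k / H i l = 0

/-- The `2 × 2` submatrix in rows `i`, `j` and columns `k`, `l` has antipodal quotients. -/
def Antipodal (H : Matrix (Fin 6) (Fin 6) F) (i j k l : Fin 6) : Prop :=
  H i k * H j l + H i l * H j k = 0

variable {H : Matrix (Fin 6) (Fin 6) F} {i j k l m n : Fin 6}

theorem IsInverseOrthogonal.transpose (hH : IsInverseOrthogonal H) :
    IsInverseOrthogonal H.transpose :=
  ⟨fun i k => hH.ne_zero k i, fun i j h => hH.col i j h, fun i j h => hH.row i j h⟩

theorem Antipodal.transpose (h : Antipodal H i j k l) : Antipodal H.transpose k l i j := by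
  unfold Antipodal at *
  simp only [Matrix.transpose_apply]
  linear_combination h

theorem antipodal_transpose : Antipodal H.transpose k l i j ↔ Antipodal H i j k l :=
  ⟨fun h => h.transpose, fun h => h.transpose⟩

theorem Antipodal.swap_rows (h : Antipodal H i j k l) : Antipodal H j i k l := by
  unfold Antipodal at *
  linear_combination h

theorem Antipodal.swap_cols (h : Antipodal H i j k l) : Antipodal H i j l k := by
  unfold Antipodal at *
  linear_combination h

theorem antipodal_swap_rows : Antipodal H i j k l ↔ Antipodal H j i k l :=
  ⟨fun h => h.swap_rows, fun h => h.swap_rows⟩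

theorem antipodal_swap_cols : Antipodal H i j k l ↔ Antipodal H i j l k :=
  ⟨fun h => h.swap_cols, fun h => h.swap_cols⟩

theorem IsInverseOrthogonal.antipodal_iff (hH : IsInverseOrthogonal H) :
    Antipodal H i j k l ↔ H i k / H j k + H i l / H j l = 0 := by
  have h1 := hH.ne_zero j k
  have h2 := hH.ne_zero j l
  rw [div_add_div _ _ h1 h2, div_eq_zero_iff, or_iff_left (mul_ne_zero h1 h2)]
  unfold Antipodal
  rw [mul_comm (H j k)]

theorem IsInverseOrthogonal.rows_ne [CharZero F] (hH : IsInverseOrthogonal H)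
    (h : Antipodal H i j k l) : i ≠ j := by
  rintro rfl
  unfold Antipodal at h
  have : (2 : F) * (H i k * H i l) = 0 := by linear_combination h
  simp [hH.ne_zero] at this

theorem IsInverseOrthogonal.cols_ne [CharZero F] (hH : IsInverseOrthogonal H)
    (h : Antipodal H i j k l) : k ≠ l :=
  hH.transpose.rows_ne h.transpose

/-- The product (a+b)(a+c)(a+d) equals a² e₁ + e₃ in the elementary symmetric functions of a, b, c,
d, and both e₁ and e₃ vanish. -/
theorem four_sum_zero {a b c d : F} (ha : a ≠ 0) (hb : b ≠ 0) (hc : c ≠ 0) (hd : d ≠ 0)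
    (h : a + b + c + d = 0) (h' : a⁻¹ + b⁻¹ + c⁻¹ + d⁻¹ = 0) :
    a + b = 0 ∨ a + c = 0 ∨ a + d = 0 := by
  field_simp at h'
  have : (a + b) * ((a + c) * (a + d)) = 0 := by
    linear_combination a ^ 2 * h + h'
  simpa using this

theorem exists_perm_zero_one (h : k ≠ l) : ∃ τ : Equiv.Perm (Fin 6), τ 0 = k ∧ τ 1 = l := by
  refine ⟨Equiv.swap (Equiv.swap 0 k 1) l * Equiv.swap 0 k, ?_, by simp⟩
  have : k ≠ Equiv.swap 0 k 1 := by
    intro e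
    have := (Equiv.swap 0 k).injective ((Equiv.swap_apply_left 0 k).trans e)
    simp at this
  simp [Equiv.swap_apply_of_ne_of_ne this h]

/-- A cancelling pair drops out of both sums, which leaves four terms for `four_sum_zero`. -/
theorem exists_matching {r : Fin 6 → F} (h0 : ∀ k, r k ≠ 0) (hs : ∑ k, r k = 0)
    (hi : ∑ k, (r k)⁻¹ = 0) (hkl : k ≠ l) (h : r k + r l = 0) :
    ∃ τ : Equiv.Perm (Fin 6), r (τ 0) + r (τ 1) = 0 ∧ r (τ 2) + r (τ 3) = 0 ∧
      r (τ 4) + r (τ 5) = 0 := by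
  obtain ⟨τ, rfl, rfl⟩ := exists_perm_zero_one hkl
  rw [← Equiv.sum_comp τ, Fin.sum_univ_six] at hs hi
  have h1 : (r (τ 0))⁻¹ + (r (τ 1))⁻¹ = 0 := by
    rw [eq_neg_of_add_eq_zero_left h, inv_neg, neg_add_cancel]
  have hs' : r (τ 2) + r (τ 3) + r (τ 4) + r (τ 5) = 0 := by linear_combination hs - h
  rcases four_sum_zero (h0 _) (h0 _) (h0 _) (h0 _) hs' (by linear_combination hi - h1)
    with h2 | h2 | h2
  · exact ⟨τ, h, h2, by linear_combination hs' - h2⟩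
  · refine ⟨τ * Equiv.swap 3 4, ?_⟩
    simp only [Equiv.Perm.mul_apply, show Equiv.swap (3 : Fin 6) 4 0 = 0 by decide,
      show Equiv.swap (3 : Fin 6) 4 1 = 1 by decide, show Equiv.swap (3 : Fin 6) 4 2 = 2 by decide,
      show Equiv.swap (3 : Fin 6) 4 3 = 4 by decide, show Equiv.swap (3 : Fin 6) 4 4 = 3 by decide,
      show Equiv.swap (3 : Fin 6) 4 5 = 5 by decide]
    exact ⟨h, h2, by linear_combination hs' - h2⟩
  · refine ⟨τ * Equiv.swap 3 5, ?_⟩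
    simp only [Equiv.Perm.mul_apply, show Equiv.swap (3 : Fin 6) 5 0 = 0 by decide,
      show Equiv.swap (3 : Fin 6) 5 1 = 1 by decide, show Equiv.swap (3 : Fin 6) 5 2 = 2 by decide,
      show Equiv.swap (3 : Fin 6) 5 3 = 5 by decide, show Equiv.swap (3 : Fin 6) 5 4 = 4 by decide,
      show Equiv.swap (3 : Fin 6) 5 5 = 3 by decide]
    exact ⟨h, h2, by linear_combination hs' - h2⟩

theorem IsInverseOrthogonal.exists_matching [CharZero F] (hH : IsInverseOrthogonal H)
    (h : Antipodal H i j k l) :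
    ∃ τ : Equiv.Perm (Fin 6), Antipodal H i j (τ 0) (τ 1) ∧ Antipodal H i j (τ 2) (τ 3) ∧
      Antipodal H i j (τ 4) (τ 5) := by
  have hij := hH.rows_ne h
  have hkl := hH.cols_ne h
  simp only [hH.antipodal_iff] at *
  refine _root_.exists_matching (r := fun k => H i k / H j k)
    (fun k => div_ne_zero (hH.ne_zero _ _) (hH.ne_zero _ _)) (hH.row i j hij) ?_ hkl h
  simpa using hH.row j i hij.symm

theorem IsInverseOrthogonal.exists_antipodal_col [CharZero F] (hH : IsInverseOrthogonal H)
    (h : Antipodal H i j k l) (n : Fin 6) : ∃ m, Antipodal H i j n m := by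
  obtain ⟨τ, h1, h2, h3⟩ := hH.exists_matching h
  obtain ⟨n, rfl⟩ := τ.surjective n
  fin_cases n
  exacts [⟨_, h1⟩, ⟨_, h1.swap_cols⟩, ⟨_, h2⟩, ⟨_, h2.swap_cols⟩, ⟨_, h3⟩, ⟨_, h3.swap_cols⟩]

theorem IsInverseOrthogonal.exists_antipodal_row [CharZero F] (hH : IsInverseOrthogonal H)
    (h : Antipodal H i j k l) (n : Fin 6) : ∃ m, Antipodal H n m k l := by
  obtain ⟨m, hm⟩ := hH.transpose.exists_antipodal_col h.transpose n
  exact ⟨m, hm.transpose⟩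

/-- The other member of a pair of consecutive indices. -/
def partner : Fin 6 → Fin 6 := ![1, 0, 3, 2, 5, 4]

@[simp] theorem partner_partner (i : Fin 6) : partner (partner i) = i := by
  revert i; decide

theorem partner_ne (i : Fin 6) : partner i ≠ i := by
  revert i; decide

/-- The last clause is an equality of multisets, so sums over all indices expand without side
conditions on distinctness. -/
theorem exists_third_pair (h : l ≠ k) (h' : l ≠ partner k) :
    ∃ n, n ≠ k ∧ n ≠ partner k ∧ n ≠ l ∧ n ≠ partner l ∧
      (Finset.univ : Finset (Fin 6)).val = {k, partner k, l, partner l, n, partner n} := by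
  revert k l; decide

theorem sum_pairs {n : Fin 6}
    (h : (Finset.univ : Finset (Fin 6)).val = {k, partner k, l, partner l, n, partner n})
    (f : Fin 6 → F) :
    ∑ x, f x = f k + f (partner k) + f l + f (partner l) + f n + f (partner n) := by
  rw [Finset.sum, h]
  simp [add_assoc]

/-- An inverse orthogonal matrix all of whose consecutive `2 × 2` blocks are antipodal. -/
structure IsBlocked (H : Matrix (Fin 6) (Fin 6) F) : Prop extends IsInverseOrthogonal H where
  block : ∀ i k, Antipodal H i (partner i) k (partner k)

theorem IsBlocked.transpose (hH : IsBlocked H) : IsBlocked H.transpose :=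
  ⟨hH.toIsInverseOrthogonal.transpose, fun i k => (hH.block k i).transpose⟩

/-- The triples a, b, c and -x, -y, -z share all elementary symmetric functions, the second one by
clearing denominators in the sum of inverses. Hence a is a root of (T+x)(T+y)(T+z). -/
theorem six_sum_zero {a b c x y z : F} (ha : a ≠ 0) (hb : b ≠ 0) (hc : c ≠ 0) (hx : x ≠ 0)
    (hy : y ≠ 0) (hz : z ≠ 0) (h : a + b + c + x + y + z = 0)
    (h' : a⁻¹ + b⁻¹ + c⁻¹ + x⁻¹ + y⁻¹ + z⁻¹ = 0) (hp : a * b * c = - (x * y * z)) :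
    a + x = 0 ∨ a + y = 0 ∨ a + z = 0 := by
  have e1 : (a * b * c) * (a⁻¹ + b⁻¹ + c⁻¹) = b * c + a * c + a * b := by field_simp
  have e2 : (x * y * z) * (x⁻¹ + y⁻¹ + z⁻¹) = y * z + x * z + x * y := by field_simp
  have e3 : b * c + a * c + a * b = y * z + x * z + x * y := by
    rw [← e1, ← e2, hp]
    linear_combination (- (x * y * z)) * h'
  have : (a + x) * ((a + y) * (a + z)) = 0 := by
    linear_combination a ^ 2 * h - a * e3 + hp
  simpa using this

/-- Antipodal rows in a blocked matrix have antipodal partner rows. -/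
theorem IsBlocked.exists_antipodal_partner [CharZero F] (hH : IsBlocked H)
    (h : Antipodal H i j k l) : ∃ m n, Antipodal H (partner i) (partner j) m n := by
  have hO := hH.toIsInverseOrthogonal
  have hij := hO.rows_ne h
  have hkl := hO.cols_ne h
  have hij' : partner i ≠ partner j := fun e => hij (by simpa using congrArg partner e)
  -- The partner rows have quotients `s c * γ c`. Here `γ` is constant on each pair of columns,
  -- because both ratios in it change sign from a column to its partner.
  obtain ⟨γ, hγ⟩ : ∃ γ : Fin 6 → F,
      γ = fun c => (H (partner i) c / H i c) / (H (partner j) c / H j c) := ⟨_, rfl⟩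
  obtain ⟨s, hs⟩ : ∃ s : Fin 6 → F, s = fun c => H i c / H j c := ⟨_, rfl⟩
  have hs0 : ∀ c, s c ≠ 0 := fun c => by
    simp [hs, hO.ne_zero]
  have hγ0 : ∀ c, γ c ≠ 0 := fun c => by
    simp [hγ, hO.ne_zero]
  have hr : ∀ c, H (partner i) c / H (partner j) c = s c * γ c := fun c => by
    have := hO.ne_zero
    simp only [hs, hγ]
    field_simp [this]
  have hγp : ∀ c, γ (partner c) = γ c := fun c => by
    have h1 := (hO.antipodal_iff).1 (hH.block i c).swap_rows
    have h2 := (hO.antipodal_iff).1 (hH.block j c).swap_rows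
    simp only [hγ]
    rw [eq_neg_of_add_eq_zero_left h1, eq_neg_of_add_eq_zero_left h2, neg_div_neg_eq]
  have key : ∀ {m n}, Antipodal H i j m n ↔ s m + s n = 0 := fun {m n} => by
    rw [hO.antipodal_iff, hs]
  have key' : ∀ {m n}, Antipodal H (partner i) (partner j) m n ↔ s m * γ m + s n * γ n = 0 :=
    fun {m n} => by rw [hO.antipodal_iff, hr, hr]
  have pair : ∀ c, s c + s (partner c) = 0 → ∃ m n, Antipodal H (partner i) (partner j) m n :=
    fun c hc => ⟨c, partner c, key'.2 (by rw [hγp]; linear_combination γ c * hc)⟩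
  rw [key] at h
  by_cases hl : l = partner k
  · subst hl
    exact pair k h
  obtain ⟨n, -, -, -, -, hn⟩ := exists_third_pair hkl.symm hl
  have S1 := hO.row i j hij
  have S2 := hO.row j i hij.symm
  have S3 := hO.row _ _ hij'
  have S4 := hO.row _ _ hij'.symm
  have hs' : ∀ c, H j c / H i c = (s c)⁻¹ := fun c => by simp [hs]
  have hr' : ∀ c, H (partner j) c / H (partner i) c = (s c * γ c)⁻¹ := fun c => by
    rw [← hr, inv_div]
  have hsc : ∀ c, H i c / H j c = s c := fun c => by simp [hs]
  simp only [sum_pairs hn, hs', hr, hr', hγp, hsc] at S1 S2 S3 S4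
  have T2 : (s k)⁻¹ + (s l)⁻¹ = 0 := by
    rw [eq_neg_of_add_eq_zero_left h, inv_neg, neg_add_cancel]
  have hne : ∀ c, s c * γ (c) ≠ 0 := fun c => mul_ne_zero (hs0 _) (hγ0 _)
  have hne' : ∀ c, s (partner c) * γ c ≠ 0 := fun c => mul_ne_zero (hs0 _) (hγ0 _)
  -- In the first case `s` cancels inside a block, and the constancy of `γ` there finishes. In the
  -- other two the cancelling pairs of `s` link the three blocks in a cycle.
  rcases four_sum_zero (hs0 (partner k)) (hs0 (partner l)) (hs0 n) (hs0 (partner n))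
    (by linear_combination S1 - h) (by linear_combination S2 - T2) with h1 | h1 | h1
  · exact pair n (by linear_combination S1 - h - h1)
  · have h2 : s (partner l) + s (partner n) = 0 := by linear_combination S1 - h - h1
    -- Each triple has one column from every block and one from every cancelling pair. The products
    -- of `γ` over the triples agree and those of `s` are opposite.
    rcases six_sum_zero (hne k) (hne' l) (hne n) (hne l) (hne' k) (hne' n)
      (by linear_combination S3) (by linear_combination S4) (by
        rw [eq_neg_of_add_eq_zero_left h, eq_neg_of_add_eq_zero_left h1,
          eq_neg_of_add_eq_zero_left h2]; ring) with h3 | h3 | h3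
    · exact ⟨k, l, key'.2 h3⟩
    · exact ⟨k, partner k, key'.2 (by rw [hγp]; exact h3)⟩
    · exact ⟨k, partner n, key'.2 (by rw [hγp]; exact h3)⟩
  · have h2 : s (partner l) + s n = 0 := by linear_combination S1 - h - h1
    rcases six_sum_zero (hne k) (hne' l) (hne' n) (hne l) (hne' k) (hne n)
      (by linear_combination S3) (by linear_combination S4) (by
        rw [eq_neg_of_add_eq_zero_left h, eq_neg_of_add_eq_zero_left h1,
          eq_neg_of_add_eq_zero_left h2]; ring) with h3 | h3 | h3
    · exact ⟨k, l, key'.2 h3⟩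
    · exact ⟨k, partner k, key'.2 (by rw [hγp]; exact h3)⟩
    · exact ⟨k, n, key'.2 h3⟩

end InverseOrthogonal

/-! ### Counting antipodal submatrices by pairs of rows -/

section Counting

variable {F : Type*} [Field F] {H : Matrix (Fin 6) (Fin 6) F} {i j k l m n : Fin 6}

open Classical in
/-- The number of ordered pairs of columns that are antipodal for the rows `i` and `j`. -/
noncomputable def rowCount (H : Matrix (Fin 6) (Fin 6) F) (i j : Fin 6) : ℕ :=
  ∑ k, ∑ l, if Antipodal H i j k l then 1 else 0

/-- The number of antipodal submatrices, over ordered pairs of rows and of columns. -/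
noncomputable def totalCount (H : Matrix (Fin 6) (Fin 6) F) : ℕ :=
  ∑ i, ∑ j, rowCount H i j

theorem sum_four_comm (g : Fin 6 → Fin 6 → Fin 6 → Fin 6 → ℕ) :
    ∑ i, ∑ j, ∑ k, ∑ l, g i j k l = ∑ k, ∑ l, ∑ i, ∑ j, g i j k l := by
  have h : ∑ p : Fin 6 × Fin 6, ∑ q : Fin 6 × Fin 6, g p.1 p.2 q.1 q.2 =
      ∑ q : Fin 6 × Fin 6, ∑ p : Fin 6 × Fin 6, g p.1 p.2 q.1 q.2 := Finset.sum_comm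
  simpa only [Fintype.sum_prod_type] using h

theorem totalCount_transpose : totalCount H.transpose = totalCount H := by
  classical
  unfold totalCount rowCount
  rw [sum_four_comm]
  exact Finset.sum_congr rfl fun i _ => Finset.sum_congr rfl fun j _ => Finset.sum_congr rfl
    fun k _ => Finset.sum_congr rfl fun l _ => if_congr antipodal_transpose rfl rfl

theorem rowCount_comm (i j : Fin 6) : rowCount H i j = rowCount H j i := by
  classical
  exact Finset.sum_congr rfl fun k _ => Finset.sum_congr rfl fun l _ =>
    if_congr antipodal_swap_rows rfl rfl

theorem sum_symmetric (f : Fin 6 → Fin 6 → ℕ) (hf : ∀ i j, f i j = f j i) (h0 : ∀ i, f i i = 0) :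
    ∑ i, ∑ j, f i j = 2 * ∑ p : Fin 6 × Fin 6 with p.1 < p.2, f p.1 p.2 := by
  have h1 : ∑ i, ∑ j, f i j = ∑ i, ∑ j, ((if i < j then f i j else 0) +
      (if j < i then f j i else 0)) := by
    refine Finset.sum_congr rfl fun i _ => Finset.sum_congr rfl fun j _ => ?_
    rcases lt_trichotomy i j with h | rfl | h
    · simp [h, h.not_gt]
    · simp [h0]
    · simp [h, h.not_gt, hf i j]
  rw [h1]
  simp only [Finset.sum_add_distrib]
  rw [Finset.sum_comm (f := fun i j => if j < i then f j i else 0), ← two_mul,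
    Finset.sum_filter, Fintype.sum_prod_type]

open Classical in
/-- The pairs of rows admitting an antipodal pair of columns. -/
noncomputable def rowEdges (H : Matrix (Fin 6) (Fin 6) F) : Finset (Fin 6 × Fin 6) :=
  {p | p.1 < p.2 ∧ ∃ k l, Antipodal H p.1 p.2 k l}

theorem rowCount_eq_zero (h : ¬ ∃ k l, Antipodal H i j k l) : rowCount H i j = 0 := by
  push Not at h
  simp [rowCount, h]

/-- An unordered pair of indices, as an ordered pair. -/
def sortedPair (i j : Fin 6) : Fin 6 × Fin 6 := if i < j then (i, j) else (j, i)

variable [CharZero F]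

namespace IsInverseOrthogonal

theorem totalCount_eq (hH : IsInverseOrthogonal H) :
    totalCount H = 2 * ∑ p ∈ rowEdges H, rowCount H p.1 p.2 := by
  classical
  have h1 : rowEdges H ⊆ ({p | p.1 < p.2} : Finset (Fin 6 × Fin 6)) := by
    refine Finset.subset_iff.2 fun p hp => ?_
    simp only [rowEdges, Finset.mem_filter] at hp ⊢
    exact ⟨hp.1, hp.2.1⟩
  rw [totalCount, sum_symmetric _ rowCount_comm
    (fun i => rowCount_eq_zero fun ⟨k, l, h⟩ => hH.rows_ne h rfl),
    Finset.sum_subset h1 fun p hp hp' => ?_]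
  refine rowCount_eq_zero fun h => hp' ?_
  simp only [rowEdges, Finset.mem_filter] at hp ⊢
  exact ⟨hp.1, hp.2, h⟩

theorem sortedPair_mem (hH : IsInverseOrthogonal H) (h : Antipodal H i j k l) :
    sortedPair i j ∈ rowEdges H := by
  have := hH.rows_ne h
  simp only [sortedPair, rowEdges, Finset.mem_filter, Finset.mem_univ, true_and]
  split_ifs with h'
  · exact ⟨h', k, l, h⟩
  · exact ⟨lt_of_le_of_ne (not_lt.1 h') this.symm, k, l, h.swap_rows⟩

/-- The quotients are ±a, ±b, ±c. The matching gives six ordered cancelling pairs, and each equality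
a = ±b, a = ±c, b = ±c adds four. -/
theorem exists_rowCount_eq (hH : IsInverseOrthogonal H) (h : Antipodal H i j k l) :
    ∃ s, rowCount H i j = 6 + 4 * s := by
  classical
  obtain ⟨τ, h1, h2, h3⟩ := hH.exists_matching h
  obtain ⟨r, hr⟩ : ∃ r : Fin 6 → F, r = fun k => H i k / H j k := ⟨_, rfl⟩
  have h0 : ∀ k, r k ≠ 0 := fun k => by simp [hr, hH.ne_zero]
  have key : ∀ {m n}, Antipodal H i j m n ↔ r m + r n = 0 := fun {m n} => by
    rw [hH.antipodal_iff, hr]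
  rw [key] at h1 h2 h3
  rw [rowCount, ← Equiv.sum_comp τ]
  simp_rw [← Equiv.sum_comp τ (fun l => if Antipodal H i j (τ _) l then 1 else 0), key]
  have e1 : r (τ 1) = - r (τ 0) := eq_neg_of_add_eq_zero_right h1
  have e2 : r (τ 3) = - r (τ 2) := eq_neg_of_add_eq_zero_right h2
  have e3 : r (τ 5) = - r (τ 4) := eq_neg_of_add_eq_zero_right h3
  simp only [Fin.sum_univ_six, e1, e2, e3]
  have a0 := h0 (τ 0)
  have b0 := h0 (τ 2)
  have c0 := h0 (τ 4)
  generalize r (τ 0) = a at *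
  generalize r (τ 2) = b at *
  generalize r (τ 4) = c at *
  have s1 : ∀ x y : F, x + y = 0 ↔ x = -y := fun x y => add_eq_zero_iff_eq_neg
  have s2 : ∀ x y : F, -x = y ↔ x = -y := fun x y => neg_eq_iff_eq_neg
  have s3 : ∀ x : F, x ≠ 0 → ¬ (x = -x) := fun x hx h => hx (self_eq_neg.1 h)
  refine ⟨(if a = b then 1 else 0) + (if a = -b then 1 else 0) + (if a = c then 1 else 0) +
    (if a = -c then 1 else 0) + (if b = c then 1 else 0) + (if b = -c then 1 else 0), ?_⟩
  simp only [s1, s2, neg_neg, s3 _ a0, s3 _ b0, s3 _ c0, if_true, if_false, eq_comm (a := b) (b := a),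
    eq_comm (a := c) (b := a), eq_comm (a := c) (b := b),
    show (b = -a) = (a = -b) from propext ⟨fun h => by rw [h, neg_neg], fun h => by rw [h, neg_neg]⟩,
    show (c = -a) = (a = -c) from propext ⟨fun h => by rw [h, neg_neg], fun h => by rw [h, neg_neg]⟩,
    show (c = -b) = (b = -c) from propext ⟨fun h => by rw [h, neg_neg], fun h => by rw [h, neg_neg]⟩]
  ring

end IsInverseOrthogonal

/-- In every pair of rows a column is antipodal to at most one other column. -/
def RowSimple (H : Matrix (Fin 6) (Fin 6) F) : Prop :=
  ∀ i j k l m, Antipodal H i j k l → Antipodal H i j k m → l = m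

/-- Some antipodal submatrix has its rows in different blocks. -/
def RowExtra (H : Matrix (Fin 6) (Fin 6) F) : Prop :=
  ∃ i j k l, Antipodal H i j k l ∧ j ≠ partner i

namespace IsInverseOrthogonal

theorem degree_eq_one (hH : IsInverseOrthogonal H) (hs : RowSimple H) (h : Antipodal H i j k l)
    (n : Fin 6) [DecidablePred (Antipodal H i j n)] :
    ∑ m, (if Antipodal H i j n m then 1 else 0) = 1 := by
  obtain ⟨m, hm⟩ := hH.exists_antipodal_col h n
  have : ∀ x, Antipodal H i j n x ↔ x = m := fun x =>
    ⟨fun hx => hs _ _ _ _ _ hx hm, fun hx => hx ▸ hm⟩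
  simp [this]

theorem rowCount_eq_six (hH : IsInverseOrthogonal H) (hs : RowSimple H)
    (h : Antipodal H i j k l) : rowCount H i j = 6 := by
  classical
  simp [rowCount, hH.degree_eq_one hs h]

/-- Every column has a partner and one has two, so the count exceeds 6; the form 6 + 4s lifts it to
10. -/
theorem ten_le_rowCount (hH : IsInverseOrthogonal H) (h : Antipodal H i j k l)
    (h' : Antipodal H i j k m) (hlm : l ≠ m) : 10 ≤ rowCount H i j := by
  classical
  have h1 : ∀ n, 1 ≤ ∑ m, (if Antipodal H i j n m then 1 else 0) := fun n => by
    obtain ⟨m, hm⟩ := hH.exists_antipodal_col h n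
    rw [Finset.sum_boole, Nat.cast_id]
    exact Finset.card_pos.2 ⟨m, by simpa using hm⟩
  have h2 : 1 < ∑ m, (if Antipodal H i j k m then 1 else 0) := by
    rw [Finset.sum_boole, Nat.cast_id]
    exact Finset.one_lt_card.2 ⟨l, by simpa using h, m, by simpa using h', hlm⟩
  have h3 : ∑ n : Fin 6, 1 < rowCount H i j :=
    Finset.sum_lt_sum (fun n _ => h1 n) ⟨k, Finset.mem_univ _, h2⟩
  obtain ⟨s, hs⟩ := hH.exists_rowCount_eq h
  rw [hs] at h3 ⊢
  simp at h3
  omega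

/-- On every edge `rowCount` is `6` plus a multiple of `4`, with equality for simple rows. -/
theorem totalCount_of_edges (hH : IsInverseOrthogonal H) :
    ∃ s, totalCount H = 12 * (rowEdges H).card + 8 * s ∧ (RowSimple H → s = 0) ∧
      (¬ RowSimple H → 1 ≤ s) := by
  have h1 : ∀ p ∈ rowEdges H, ∃ s, rowCount H p.1 p.2 = 6 + 4 * s := fun p hp => by
    simp only [rowEdges, Finset.mem_filter] at hp
    obtain ⟨-, -, k, l, h⟩ := hp
    exact hH.exists_rowCount_eq h
  choose! s hs using h1
  have h2 : totalCount H = 12 * (rowEdges H).card + 8 * ∑ p ∈ rowEdges H, s p := by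
    rw [hH.totalCount_eq, Finset.sum_congr rfl hs, Finset.sum_add_distrib, ← Finset.mul_sum]
    simp
    ring
  refine ⟨_, h2, fun h => ?_, fun h => ?_⟩
  · refine Finset.sum_eq_zero fun p hp => ?_
    have h3 := hs p hp
    simp only [rowEdges, Finset.mem_filter] at hp
    obtain ⟨-, -, k, l, h4⟩ := hp
    rw [hH.rowCount_eq_six h h4] at h3
    omega
  · unfold RowSimple at h
    push Not at h
    obtain ⟨i, j, k, l, m, h3, h4, h5⟩ := h
    have h6 := hH.ten_le_rowCount h3 h4 h5
    have h7 := hH.sortedPair_mem h3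
    refine le_trans ?_ (Finset.single_le_sum (f := s) (fun _ _ => Nat.zero_le _) h7)
    have h8 : rowCount H (sortedPair i j).1 (sortedPair i j).2 = rowCount H i j := by
      unfold sortedPair
      split_ifs
      · rfl
      · exact rowCount_comm _ _
    have := hs _ h7
    omega

end IsInverseOrthogonal

theorem eq_partner_of_ne : ∀ i j m q : Fin 6, (j ≠ partner i ∧ i ≠ j ∧ m ≠ i ∧ m ≠ partner i ∧
    m ≠ j ∧ m ≠ partner j ∧ q ≠ i ∧ q ≠ j ∧ q ≠ partner i ∧ q ≠ partner j ∧ q ≠ m) →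
      q = partner m := by
  decide

namespace IsBlocked

/-- The edges are the three blocks, the extra edge and its partner edge; the last two differ because
`j ≠ partner i`. -/
theorem five_le_card_rowEdges (hH : IsBlocked H) (h : RowExtra H) : 5 ≤ (rowEdges H).card := by
  obtain ⟨i, j, k, l, h1, h2⟩ := h
  obtain ⟨m, n, h3⟩ := hH.exists_antipodal_partner h1
  have hO := hH.toIsInverseOrthogonal
  have h4 := hO.rows_ne h1
  have h5 : ({sortedPair 0 1, sortedPair 2 3, sortedPair 4 5, sortedPair i j,
      sortedPair (partner i) (partner j)} : Finset (Fin 6 × Fin 6)) ⊆ rowEdges H := by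
    simp only [Finset.insert_subset_iff, Finset.singleton_subset_iff]
    exact ⟨hO.sortedPair_mem (hH.block 0 0), hO.sortedPair_mem (hH.block 2 0),
      hO.sortedPair_mem (hH.block 4 0), hO.sortedPair_mem h1, hO.sortedPair_mem h3⟩
  refine le_trans (le_of_eq ?_) (Finset.card_le_card h5)
  clear h1 h3 h5
  revert i j
  decide

/-- By simplicity the columns `e`, `f` match the six rows perfectly, and never a row with its
partner. If both `i`, `j` and their partners were matched, the third block would be matched within
itself. So `partner i` is matched to a row `q` of the third block, and the two outside edges with
their partner edges make four. -/
theorem seven_le_card_rowEdges (hH : IsBlocked H) (hr : RowSimple H) (hc : RowSimple H.transpose)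
    (h : RowExtra H) : 7 ≤ (rowEdges H).card := by
  obtain ⟨i, j, e, f, h1, h2⟩ := h
  have hO := hH.toIsInverseOrthogonal
  have h4 := hO.rows_ne h1
  have hc' : ∀ {i j m k l}, Antipodal H i j k l → Antipodal H i m k l → j = m :=
    fun h h' => hc _ _ _ _ _ h.transpose h'.transpose
  have hef : f ≠ partner e := by
    rintro rfl
    exact h2 (hc' h1 (hH.block i e))
  have hblock : ∀ i, ¬ Antipodal H i (partner i) e f := fun i hi =>
    hef (hr _ _ _ _ _ hi (hH.block i e))
  have hpp : ¬ Antipodal H (partner i) (partner j) e f := fun h3 => by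
    obtain ⟨m, hm1, hm2, hm3, hm4⟩ : ∃ m : Fin 6, m ≠ i ∧ m ≠ partner i ∧ m ≠ j ∧
        m ≠ partner j := by
      clear h1 h3
      revert i j
      decide
    obtain ⟨q, hq⟩ := hO.exists_antipodal_row h1 m
    have q1 : q ≠ i := fun e => hm3 (hc' (e ▸ hq.swap_rows) h1)
    have q2 : q ≠ j := fun e => hm1 (hc' (e ▸ hq.swap_rows) h1.swap_rows)
    have q3 : q ≠ partner i := fun e => hm4 (hc' (e ▸ hq.swap_rows) h3)
    have q4 : q ≠ partner j := fun e => hm2 (hc' (e ▸ hq.swap_rows) h3.swap_rows)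
    have q5 : q ≠ m := (hO.rows_ne hq).symm
    have q6 := eq_partner_of_ne i j m q ⟨h2, h4, hm1, hm2, hm3, hm4, q1, q2, q3, q4, q5⟩
    exact hblock m (q6 ▸ hq)
  obtain ⟨q, hq⟩ := hO.exists_antipodal_row h1 (partner i)
  have q1 : q ≠ i := fun e => hblock i (e ▸ hq).swap_rows
  have q2 : q ≠ j := fun e => partner_ne i (hc' (e ▸ hq.swap_rows) h1.swap_rows)
  have q3 : q ≠ partner i := (hO.rows_ne hq).symm
  have q4 : q ≠ partner j := fun e => hpp (e ▸ hq)
  obtain ⟨m, n, h5⟩ := hH.exists_antipodal_partner h1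
  obtain ⟨m', n', h6⟩ := hH.exists_antipodal_partner hq
  rw [partner_partner] at h6
  have h7 : ({sortedPair 0 1, sortedPair 2 3, sortedPair 4 5, sortedPair i j,
      sortedPair (partner i) (partner j), sortedPair (partner i) q, sortedPair i (partner q)} :
      Finset (Fin 6 × Fin 6)) ⊆ rowEdges H := by
    simp only [Finset.insert_subset_iff, Finset.singleton_subset_iff]
    exact ⟨hO.sortedPair_mem (hH.block 0 0), hO.sortedPair_mem (hH.block 2 0),
      hO.sortedPair_mem (hH.block 4 0), hO.sortedPair_mem h1, hO.sortedPair_mem h5,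
      hO.sortedPair_mem hq, hO.sortedPair_mem h6⟩
  refine le_trans (le_of_eq ?_) (Finset.card_le_card h7)
  clear h1 hq h5 h6 h7 hblock hpp
  revert i j q
  decide

theorem card_rowEdges_eq_three (hH : IsBlocked H) (h : ¬ RowExtra H) :
    (rowEdges H).card = 3 := by
  have hO := hH.toIsInverseOrthogonal
  have : rowEdges H = {sortedPair 0 1, sortedPair 2 3, sortedPair 4 5} := by
    apply Finset.Subset.antisymm
    · rintro ⟨i, j⟩ hp
      simp only [rowEdges, Finset.mem_filter] at hp
      obtain ⟨-, hlt, k, l, h1⟩ := hp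
      have h2 : j = partner i := by
        by_contra h2
        exact h ⟨i, j, k, l, h1, h2⟩
      clear h1
      revert i j
      decide
    · simp only [Finset.insert_subset_iff, Finset.singleton_subset_iff]
      exact ⟨hO.sortedPair_mem (hH.block 0 0), hO.sortedPair_mem (hH.block 2 0),
        hO.sortedPair_mem (hH.block 4 0)⟩
  rw [this]
  decide

-- Of two distinct columns antipodal to `k`, at most one is `partner k`.
omit [CharZero F] in
theorem rowExtra_transpose (h : ¬ RowSimple H) : RowExtra H.transpose := by
  unfold RowSimple at h
  push Not at h
  obtain ⟨i, j, k, l, m, h1, h2, h3⟩ := h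
  by_cases h4 : l = partner k
  · exact ⟨_, _, _, _, h2.transpose, fun h5 => h3 (h4.trans h5.symm)⟩
  · exact ⟨_, _, _, _, h1.transpose, h4⟩

end IsBlocked

end Counting

/-! ### The possible totals -/

section Classification

variable {F : Type*} [Field F] {H : Matrix (Fin 6) (Fin 6) F} {i j k l m n : Fin 6}

theorem three_sum_zero {u v w : F} (hu : u ≠ 0) (hv : v ≠ 0) (hw : w ≠ 0) (h : u + v + w = 0)
    (h' : u⁻¹ + v⁻¹ + w⁻¹ = 0) : u ^ 2 + u * v + v ^ 2 = 0 := by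
  field_simp at h'
  linear_combination (u + v) * h - h'

/-- With Y = x₀ + x₂ and X = x₁ + x₃, the quadratic relations say that the sums of inverses are 1/Y
and 1/X. Comparing the two sums gives x₄ + x₅ = 0 or XY = x₄x₅. In the latter case the two
difference relations become b(X - Y) = a(x₄ - x₅) and a(X - Y) = b(x₄ - x₅), so (x₄ - x₅)(a² - b²) =
0. -/
theorem six_sum_zero_of_cube_roots {x₀ x₁ x₂ x₃ x₄ x₅ a b : F} (h₀ : x₀ ≠ 0) (h₁ : x₁ ≠ 0)
    (h₂ : x₂ ≠ 0) (h₃ : x₃ ≠ 0) (h₄ : x₄ ≠ 0) (h₅ : x₅ ≠ 0) (ha : a ≠ 0) (hb : b ≠ 0)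
    (hs : x₀ + x₁ + x₂ + x₃ + x₄ + x₅ = 0)
    (hs' : x₀⁻¹ + x₁⁻¹ + x₂⁻¹ + x₃⁻¹ + x₄⁻¹ + x₅⁻¹ = 0)
    (hd : a⁻¹ * (x₀ - x₁ + x₂ - x₃) + b⁻¹ * (x₄ - x₅) = 0)
    (hd' : a * (x₀⁻¹ - x₁⁻¹ + x₂⁻¹ - x₃⁻¹) + b * (x₄⁻¹ - x₅⁻¹) = 0)
    (h02 : x₀ ^ 2 + x₀ * x₂ + x₂ ^ 2 = 0) (h13 : x₁ ^ 2 + x₁ * x₃ + x₃ ^ 2 = 0) :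
    x₄ + x₅ = 0 ∨ x₄ = x₅ ∨ a + b = 0 ∨ a = b := by
  have hY : (x₀ + x₂) * (x₀⁻¹ + x₂⁻¹) = 1 := by
    field_simp
    linear_combination h02
  have hX : (x₁ + x₃) * (x₁⁻¹ + x₃⁻¹) = 1 := by
    field_simp
    linear_combination h13
  have hS : (x₄⁻¹ + x₅⁻¹) * (x₄ * x₅) = x₄ + x₅ := by field_simp; ring
  have hD : (x₄⁻¹ - x₅⁻¹) * (x₄ * x₅) = x₅ - x₄ := by field_simp
  have hd2 : b * (x₀ - x₁ + x₂ - x₃) + a * (x₄ - x₅) = 0 := by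
    field_simp at hd
    linear_combination hd
  generalize x₄⁻¹ = y₄ at *
  generalize x₅⁻¹ = y₅ at *
  obtain ⟨Y', hY'⟩ : ∃ Y', Y' = x₀⁻¹ + x₂⁻¹ := ⟨_, rfl⟩
  obtain ⟨X', hX'⟩ : ∃ X', X' = x₁⁻¹ + x₃⁻¹ := ⟨_, rfl⟩
  obtain ⟨Y, hY0⟩ : ∃ Y, Y = x₀ + x₂ := ⟨_, rfl⟩
  obtain ⟨X, hX0⟩ : ∃ X, X = x₁ + x₃ := ⟨_, rfl⟩
  rw [← hY', ← hY0] at hY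
  rw [← hX', ← hX0] at hX
  have e1 : X + Y = -(x₄ + x₅) := by linear_combination hX0 + hY0 + hs
  have e2 : X' + Y' = -(y₄ + y₅) := by linear_combination hX' + hY' + hs'
  have e3 : b * (Y - X) = - a * (x₄ - x₅) := by linear_combination b * (hY0 - hX0) + hd2
  have e4 : a * (Y' - X') = - b * (y₄ - y₅) := by linear_combination a * (hY' - hX') + hd'
  have e5 : X + Y = -(y₄ + y₅) * (X * Y) := by
    linear_combination (X * Y) * e2 - X * hY - Y * hX
  have e6 : (x₄ + x₅) * (x₄ * x₅ - X * Y) = 0 := by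
    linear_combination (x₄ * x₅) * e1 - (x₄ * x₅) * e5 + X * Y * hS
  rcases mul_eq_zero.1 e6 with h | h
  · exact Or.inl h
  have e7 : a * (X - Y) = - b * (y₄ - y₅) * (X * Y) := by
    linear_combination (X * Y) * e4 - a * X * hY + a * Y * hX
  have e8 : a * (X - Y) = b * (x₄ - x₅) := by
    linear_combination e7 + b * (y₄ - y₅) * h - b * hD
  have e9 : (x₄ - x₅) * ((a + b) * (a - b)) = 0 := by
    linear_combination a * e3 + b * e8
  rcases mul_eq_zero.1 e9 with h | h
  · exact Or.inr (Or.inl (sub_eq_zero.1 h))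
  rcases mul_eq_zero.1 h with h | h
  · exact Or.inr (Or.inr (Or.inl h))
  · exact Or.inr (Or.inr (Or.inr (sub_eq_zero.1 h)))

variable [CharZero F]

namespace IsBlocked

/-- As the quotient of the columns is constant on row pairs, their orthogonality is twice a relation
among three terms, to which `three_sum_zero` applies. -/
theorem cube_roots (hH : IsBlocked H) (hkl : k ≠ l) (hm : m ≠ i) (hm' : m ≠ partner i)
    (hp : ∀ r, H (partner r) k / H (partner r) l = H r k / H r l) :
    (H m k / H i k) ^ 2 + (H m k / H i k) * (H m l / H i l) + (H m l / H i l) ^ 2 = 0 := by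
  have hO := hH.toIsInverseOrthogonal
  have h0 := hO.ne_zero
  obtain ⟨q, -, -, -, -, hq⟩ := exists_third_pair hm hm'
  have c1 := hO.col k l hkl
  have c2 := hO.col l k hkl.symm
  have hp' : ∀ r, H (partner r) l / H (partner r) k = H r l / H r k := fun r => by
    rw [← inv_div, hp, inv_div]
  rw [sum_pairs hq] at c1 c2
  simp only [hp, hp'] at c1 c2
  have h2 : (2 : F) ≠ 0 := two_ne_zero
  have key := three_sum_zero (u := H m k / H m l) (v := H i k / H i l) (w := H q k / H q l)
    (div_ne_zero (h0 _ _) (h0 _ _)) (div_ne_zero (h0 _ _) (h0 _ _))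
    (div_ne_zero (h0 _ _) (h0 _ _)) (mul_left_cancel₀ h2 (by linear_combination c1))
    (mul_left_cancel₀ h2 (by simp only [inv_div]; linear_combination c2))
  -- Passes from quotients of columns within a row to quotients of rows within a column.
  have e : ∀ x y z w : F, x ≠ 0 → y ≠ 0 → z ≠ 0 → w ≠ 0 →
      (x / y) ^ 2 + x / y * (z / w) + (z / w) ^ 2 =
        (z / y) ^ 2 * ((x / z) ^ 2 + x / z * (y / w) + (y / w) ^ 2) := by
    intro x y z w hx hy hz hw
    field_simp
  rw [e _ _ _ _ (h0 _ _) (h0 _ _) (h0 _ _) (h0 _ _), key, mul_zero]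

/-- Without outside edges, columns `k`, `l` match every row with its partner. So `k` and `partner l`
have a quotient constant on row pairs, as have `partner k` and `l`, and `cube_roots` applies to
both. -/
theorem antipodal_third (hH : IsBlocked H) (hc : RowSimple H.transpose) (he : ¬ RowExtra H)
    (h : Antipodal H i (partner i) k l) (hl : l ≠ partner k)
    (hn : (Finset.univ : Finset (Fin 6)).val = {k, partner k, l, partner l, n, partner n}) :
    Antipodal H i (partner i) k n ∨ Antipodal H i (partner i) k (partner n) := by
  have hO := hH.toIsInverseOrthogonal
  have h0 := hO.ne_zero
  have hkl := hO.cols_ne h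
  obtain ⟨m, hm, hm'⟩ : ∃ m, m ≠ i ∧ m ≠ partner i := by
    clear h
    revert i
    decide
  have hall : ∀ r, Antipodal H (partner r) r k l := fun r => by
    obtain ⟨s, hs⟩ := hO.exists_antipodal_row h r
    have : s = partner r := by
      by_contra h'
      exact he ⟨_, _, _, _, hs, h'⟩
    exact (this ▸ hs).swap_rows
  obtain ⟨β, hβ⟩ : ∃ β : Fin 6 → Fin 6 → F, β = fun r c => H (partner r) c / H r c := ⟨_, rfl⟩
  have hβ0 : ∀ r c, β r c ≠ 0 := fun r c => by simp [hβ, h0]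
  have hβp : ∀ r c, β r (partner c) = - β r c := fun r c => by
    have := hO.antipodal_iff.1 (hH.block r c).swap_rows
    simp only [hβ]
    linear_combination this
  have hβl : ∀ r, β r l = - β r k := fun r => by
    have := hO.antipodal_iff.1 (hall r)
    simp only [hβ]
    linear_combination this
  have hcols : ∀ c d, (∀ r, β r c = β r d) →
      ∀ r, H (partner r) c / H (partner r) d = H r c / H r d := fun c d hcd r => by
    have := hcd r
    simp only [hβ] at this
    rw [div_eq_div_iff (h0 _ _) (h0 _ _)] at this ⊢
    linear_combination this
  have c02 := hH.cube_roots (k := k) (l := partner l)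
    (fun e => hl (by rw [e, partner_partner])) hm hm'
    (hcols _ _ fun r => by rw [hβp, hβl, neg_neg])
  have c13 := hH.cube_roots (k := partner k) (l := l) hl.symm hm hm'
    (hcols _ _ fun r => by rw [hβp, hβl])
  obtain ⟨x, hx⟩ : ∃ x : Fin 6 → F, x = fun c => H m c / H i c := ⟨_, rfl⟩
  have hx0 : ∀ c, x c ≠ 0 := fun c => by simp [hx, h0]
  have r1 : ∑ c, x c = 0 := by simpa only [hx] using hO.row m i hm
  have r2 : ∑ c, (x c)⁻¹ = 0 := by simpa only [hx, inv_div] using hO.row i m hm.symm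
  have r3 : ∑ c, x c / β i c = 0 := by
    rw [← hO.row m (partner i) hm']
    refine Finset.sum_congr rfl fun c _ => ?_
    simp only [hx, hβ]
    rw [div_div_div_cancel_right₀ (h0 _ _)]
  have r4 : ∑ c, β i c * (x c)⁻¹ = 0 := by
    rw [← hO.row (partner i) m hm'.symm]
    refine Finset.sum_congr rfl fun c _ => ?_
    simp only [hx, hβ, inv_div]
    rw [div_mul_div_cancel₀ (h0 _ _)]
  rw [sum_pairs hn] at r1 r2 r3 r4
  simp only [hβp, hβl, neg_neg, div_neg] at r3 r4
  have main := six_sum_zero_of_cube_roots (hx0 k) (hx0 (partner k)) (hx0 (partner l)) (hx0 l)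
    (hx0 n) (hx0 (partner n)) (hβ0 i k) (hβ0 i n) (by linear_combination r1)
    (by linear_combination r2) (by simp only [div_eq_mul_inv] at r3; linear_combination r3)
    (by linear_combination r4) (by simpa only [hx] using c02) (by simpa only [hx] using c13)
  have hc' : ∀ {i j m k l}, Antipodal H i j k l → Antipodal H i m k l → j = m :=
    fun h h' => hc _ _ _ _ _ h.transpose h'.transpose
  -- The first two cases match row `i` in columns `n`, `partner n` with `m` or `partner m` besides
  -- `partner i`, against column simplicity.
  rcases main with h1 | h1 | h1 | h1
  · have h2 : Antipodal H m i n (partner n) := hO.antipodal_iff.2 (by simpa only [hx] using h1)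
    exact absurd (hc' h2.swap_rows (hH.block i n)) hm'
  · have h2 : Antipodal H (partner m) i n (partner n) := by
      refine hO.antipodal_iff.2 ?_
      have e : ∀ c, H (partner m) c / H i c = β m c * x c := fun c => by
        simp only [hx, hβ]
        rw [div_mul_div_cancel₀ (h0 _ _)]
      rw [e, e, hβp, h1]
      ring
    have h3 := hc' h2.swap_rows (hH.block i n)
    exact absurd (by simpa using congrArg partner h3) hm
  · exact Or.inl (Antipodal.swap_rows (hO.antipodal_iff.2 (by simpa only [hβ] using h1)))
  · refine Or.inr (Antipodal.swap_rows (hO.antipodal_iff.2 ?_))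
    have := hβp i n
    simp only [hβ] at this h1
    rw [this, h1, add_neg_cancel]

/-- The quotient takes one value on `k`, `partner l`, `partner n` and its negative on `partner k`,
`l`, `n`, so all nine cross pairs cancel. -/
theorem nine_le_card_rowEdges_transpose (hH : IsBlocked H) (h : Antipodal H i (partner i) k l)
    (hl : l ≠ partner k) (h' : Antipodal H i (partner i) k n)
    (hn : n ≠ k ∧ n ≠ partner k ∧ n ≠ l ∧ n ≠ partner l) :
    9 ≤ (rowEdges H.transpose).card := by
  have hO := hH.toIsInverseOrthogonal
  have hkl := hO.cols_ne h
  obtain ⟨r, hr⟩ : ∃ r : Fin 6 → F, r = fun c => H i c / H (partner i) c := ⟨_, rfl⟩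
  have key : ∀ {c d}, Antipodal H i (partner i) c d ↔ r c + r d = 0 := fun {c d} => by
    rw [hO.antipodal_iff, hr]
  have hk := key.1 (hH.block i k)
  have hl' := key.1 (hH.block i l)
  have hn' := key.1 (hH.block i n)
  rw [key] at h h'
  have mem : ∀ {c d}, r c + r d = 0 → sortedPair c d ∈ rowEdges H.transpose := fun hcd =>
    hO.transpose.sortedPair_mem (key.2 hcd).transpose
  have hsub : ({sortedPair k (partner k), sortedPair k l, sortedPair k n,
      sortedPair (partner l) (partner k), sortedPair (partner l) l, sortedPair (partner l) n,
      sortedPair (partner n) (partner k), sortedPair (partner n) l, sortedPair (partner n) n} :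
      Finset (Fin 6 × Fin 6)) ⊆ rowEdges H.transpose := by
    simp only [Finset.insert_subset_iff, Finset.singleton_subset_iff]
    exact ⟨mem hk, mem h, mem h', mem (by linear_combination hk + hl' - h),
      mem (by linear_combination hl'), mem (by linear_combination hl' + h' - h),
      mem (by linear_combination hk + hn' - h'), mem (by linear_combination hn' + h - h'),
      mem (by linear_combination hn')⟩
  refine le_trans (le_of_eq ?_) (Finset.card_le_card hsub)
  clear h h' hk hl' hn' hsub hO
  revert k l n
  decide

/-- The total is 12E + 8s with E ≥ 5 and s ≥ 1: it is 68 at (5, 1) and at least 76 otherwise. -/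
theorem totalCount_of_not_rowSimple_of_rowExtra (hH : IsBlocked H) (hr : ¬ RowSimple H)
    (he : RowExtra H) : totalCount H = 68 ∨ 72 < totalCount H := by
  obtain ⟨s, hs, -, h1⟩ := hH.toIsInverseOrthogonal.totalCount_of_edges
  have := h1 hr
  have := hH.five_le_card_rowEdges he
  omega

theorem totalCount_of_not_rowSimple (hH : IsBlocked H) (hr : ¬ RowSimple H) :
    totalCount H = 68 ∨ 72 < totalCount H := by
  by_cases hc : RowSimple H.transpose
  swap
  · rw [← totalCount_transpose]
    exact hH.transpose.totalCount_of_not_rowSimple_of_rowExtra hc (rowExtra_transpose hr)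
  by_cases he : RowExtra H
  · exact hH.totalCount_of_not_rowSimple_of_rowExtra hr he
  right
  have hO := hH.toIsInverseOrthogonal
  obtain ⟨i, j, k, l, h1, h2⟩ : ∃ i j k l, Antipodal H i j k l ∧ l ≠ partner k := by
    obtain ⟨k, l, i, j, h1, h2⟩ := rowExtra_transpose hr
    exact ⟨i, j, k, l, h1.transpose, h2⟩
  obtain rfl : j = partner i := by
    by_contra h3
    exact he ⟨_, _, _, _, h1, h3⟩
  obtain ⟨n, n1, n2, n3, n4, hn⟩ := exists_third_pair (hO.cols_ne h1).symm h2
  have h9 : 9 ≤ (rowEdges H.transpose).card := by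
    rcases hH.antipodal_third hc he h1 h2 hn with h3 | h3
    · exact hH.nine_le_card_rowEdges_transpose h1 h2 h3 ⟨n1, n2, n3, n4⟩
    · refine hH.nine_le_card_rowEdges_transpose h1 h2 h3 ?_
      clear h1 h3 hn hO
      revert k l n
      decide
  obtain ⟨s, hs, -⟩ := hO.transpose.totalCount_of_edges
  rw [totalCount_transpose] at hs
  omega

theorem totalCount_trichotomy (hH : IsBlocked H) :
    totalCount H = 36 ∨ totalCount H = 68 ∨ 72 < totalCount H := by
  by_cases hr : RowSimple H
  swap
  · exact Or.inr (hH.totalCount_of_not_rowSimple hr)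
  by_cases hc : RowSimple H.transpose
  swap
  · rw [← totalCount_transpose]
    exact Or.inr (hH.transpose.totalCount_of_not_rowSimple hc)
  obtain ⟨s, hs, h1, -⟩ := hH.toIsInverseOrthogonal.totalCount_of_edges
  have h1 := h1 hr
  by_cases he : RowExtra H
  · have := hH.seven_le_card_rowEdges hr hc he
    omega
  · have := hH.card_rowEdges_eq_three he
    omega

end IsBlocked

end Classification

/-! ### Transfer to complex Hadamard matrices -/

section Hadamard

variable {H K : Matrix (Fin 6) (Fin 6) ℂ} {i j k l : Fin 6}

theorem Matrix.IsHadamard.apply_ne_zero (hH : H.IsHadamard) (i j : Fin 6) : H i j ≠ 0 := by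
  intro h
  have := Unitary.star_mul_self_of_mem (hH.apply_mem i j)
  simp [h] at this

theorem Matrix.IsHadamard.star_apply (hH : H.IsHadamard) (i j : Fin 6) :
    star (H i j) = (H i j)⁻¹ :=
  eq_inv_of_mul_eq_one_left (Unitary.star_mul_self_of_mem (hH.apply_mem i j))

theorem Matrix.IsHadamard.isInverseOrthogonal (hH : H.IsHadamard) : IsInverseOrthogonal H := by
  refine ⟨hH.apply_ne_zero, fun i j hij => ?_, fun k l hkl => ?_⟩
  · have := congrFun (congrFun hH.mul_conjTranspose i) j
    simpa [Matrix.mul_apply, hH.star_apply, hij, div_eq_mul_inv, -RCLike.star_def] using this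
  · have := congrFun (congrFun hH.conjTranspose_mul l) k
    simpa [Matrix.mul_apply, hH.star_apply, hkl.symm, div_eq_mul_inv, mul_comm,
      -RCLike.star_def] using this

theorem isHadamard_two_iff {A : Matrix (Fin 2) (Fin 2) ℂ} (hA : ∀ a b, A a b ∈ unitary ℂ) :
    A.IsHadamard ↔ A 0 0 * A 1 1 + A 0 1 * A 1 0 = 0 := by
  have hs : ∀ a b, star (A a b) = (A a b)⁻¹ := fun a b =>
    eq_inv_of_mul_eq_one_left (Unitary.star_mul_self_of_mem (hA a b))
  have h0 : ∀ a b, A a b ≠ 0 := fun a b h => by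
    have := Unitary.star_mul_self_of_mem (hA a b)
    simp [h] at this
  have h1 := h0 0 0
  have h2 := h0 0 1
  have h3 := h0 1 0
  have h4 := h0 1 1
  constructor
  · intro h
    have := congrFun (congrFun h.mul_conjTranspose 0) 1
    simp [Matrix.mul_apply, Fin.sum_univ_two, hs, -RCLike.star_def] at this
    field_simp at this
    linear_combination this
  · intro h
    refine ⟨hA, ?_, ?_⟩
    · ext a b
      fin_cases a <;> fin_cases b <;>
        simp [Matrix.mul_apply, Fin.sum_univ_two, hs, -RCLike.star_def, h1, h2, h3, h4] <;>
        field_simp <;> norm_num <;> linear_combination h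
    · ext a b
      fin_cases a <;> fin_cases b <;>
        simp [Matrix.mul_apply, Fin.sum_univ_two, hs, -RCLike.star_def, h1, h2, h3, h4] <;>
        field_simp <;> norm_num <;> linear_combination h

theorem Matrix.IsHadamard.submatrix_iff (hH : H.IsHadamard) :
    (H.submatrix ![i, j] ![k, l]).IsHadamard ↔ Antipodal H i j k l :=
  isHadamard_two_iff fun _ _ => hH.apply_mem _ _

/-- Both orders of the rows and both orders of the columns are counted in `totalCount`. -/
theorem Matrix.IsHadamard.four_mul_numHadamardSubmatrices (hH : H.IsHadamard) :
    4 * numHadamardSubmatrices H = totalCount H := by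
  classical
  have hO := hH.isInverseOrthogonal
  have h1 : ∀ i j, rowCount H i j =
      2 * ∑ q : Fin 6 × Fin 6 with q.1 < q.2, if Antipodal H i j q.1 q.2 then 1 else 0 :=
    fun i j => by
      rw [rowCount]
      convert sum_symmetric (fun k l => if Antipodal H i j k l then 1 else 0)
        (fun k l => if_congr antipodal_swap_cols rfl rfl)
        (fun k => if_neg fun h => hO.cols_ne h rfl)
  rw [totalCount, sum_symmetric _ rowCount_comm
    (fun i => rowCount_eq_zero fun ⟨k, l, h⟩ => hO.rows_ne h rfl)]
  simp only [h1, ← Finset.mul_sum]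
  have h2 : ∀ f : Fin 6 × Fin 6 → ℕ,
      ∑ p : Fin 6 × Fin 6 with p.1 < p.2, f p = ∑ p, if p.1 < p.2 then f p else 0 :=
    fun f => Finset.sum_filter _ _
  have h3 : numHadamardSubmatrices H = ∑ p : Fin 6 × Fin 6 with p.1 < p.2,
      ∑ q : Fin 6 × Fin 6 with q.1 < q.2, if Antipodal H p.1 p.2 q.1 q.2 then 1 else 0 := by
    rw [numHadamardSubmatrices, Finset.card_filter, Fintype.sum_prod_type]
    simp only [h2, hH.submatrix_iff]
    refine Fintype.sum_congr _ _ fun p => ?_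
    by_cases hp : p.1 < p.2
    · rw [if_pos hp]
      refine Fintype.sum_congr _ _ fun q => ?_
      by_cases hq : q.1 < q.2 <;> simp [hp, hq]
    · simp [hp]
  rw [h3]
  ring

theorem ComplexEquivalent.isInverseOrthogonal (h : ComplexEquivalent H K)
    (hH : IsInverseOrthogonal H) : IsInverseOrthogonal K := by
  obtain ⟨σ, τ, d, e, hd, he, hK⟩ := h
  have hd0 : ∀ i, d i ≠ 0 := fun i => norm_ne_zero_iff.1 (by simp [hd])
  have he0 : ∀ i, e i ≠ 0 := fun i => norm_ne_zero_iff.1 (by simp [he])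
  have h0 := hH.ne_zero
  refine ⟨fun i k => by simp [hK, hd0, he0, h0], fun i j hij => ?_, fun k l hkl => ?_⟩
  · have h1 : ∀ c, K i c / K j c = d i / d j * (H (σ i) (τ c) / H (σ j) (τ c)) := fun c => by
      rw [hK, hK]
      field_simp [hd0, he0, h0]
    simp only [h1, ← Finset.mul_sum]
    rw [Equiv.sum_comp τ fun c => H (σ i) c / H (σ j) c, hH.row _ _ (σ.injective.ne hij), mul_zero]
  · have h1 : ∀ c, K c k / K c l = e k / e l * (H (σ c) (τ k) / H (σ c) (τ l)) := fun c => by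
      rw [hK, hK]
      field_simp [hd0, he0, h0]
    simp only [h1, ← Finset.mul_sum]
    rw [Equiv.sum_comp σ fun c => H c (τ k) / H c (τ l), hH.col _ _ (τ.injective.ne hkl), mul_zero]

theorem ComplexEquivalent.totalCount_eq (h : ComplexEquivalent H K) :
    totalCount K = totalCount H := by
  classical
  obtain ⟨σ, τ, d, e, hd, he, hK⟩ := h
  have hd0 : ∀ i, d i ≠ 0 := fun i => norm_ne_zero_iff.1 (by simp [hd])
  have he0 : ∀ i, e i ≠ 0 := fun i => norm_ne_zero_iff.1 (by simp [he])
  have h1 : ∀ i j k l, Antipodal K i j k l ↔ Antipodal H (σ i) (σ j) (τ k) (τ l) :=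
    fun i j k l => by
      unfold Antipodal
      have : K i k * K j l + K i l * K j k = d i * d j * e k * e l *
          (H (σ i) (τ k) * H (σ j) (τ l) + H (σ i) (τ l) * H (σ j) (τ k)) := by
        simp only [hK]
        ring
      rw [this, mul_eq_zero_iff_left (by simp [hd0, he0])]
  have h2 : ∀ i j, rowCount K i j = rowCount H (σ i) (σ j) := fun i j => by
    refine Eq.trans (Fintype.sum_congr _ _ fun k => ?_) (Equiv.sum_comp τ _)
    refine Eq.trans (Fintype.sum_congr _ _ fun l => ?_) (Equiv.sum_comp τ _)
    exact if_congr (h1 i j k l) rfl rfl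
  simp only [totalCount, h2]
  rw [Equiv.sum_comp σ fun i => ∑ j, rowCount H i (σ j)]
  exact Finset.sum_congr rfl fun i _ => Equiv.sum_comp σ fun j => rowCount H i j

theorem isBlocked_of_submatrix (hK : IsInverseOrthogonal K)
    (h : ∀ a b : Fin 3, (K.submatrix (pairIndex a) (pairIndex b)).IsHadamard) : IsBlocked K := by
  refine ⟨hK, ?_⟩
  have h1 : ∀ a b : Fin 3, Antipodal K (pairIndex a 0) (pairIndex a 1) (pairIndex b 0)
      (pairIndex b 1) := fun a b =>
    (isHadamard_two_iff (h a b).apply_mem).1 (h a b)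
  have h2 : ∀ i : Fin 6, ∃ a : Fin 3, (i = pairIndex a 0 ∧ partner i = pairIndex a 1) ∨
      (i = pairIndex a 1 ∧ partner i = pairIndex a 0) := by decide
  intro i k
  obtain ⟨a, ⟨ha, ha'⟩ | ⟨ha, ha'⟩⟩ := h2 i <;> obtain ⟨b, ⟨hb, hb'⟩ | ⟨hb, hb'⟩⟩ := h2 k <;>
    rw [ha', hb', ha, hb]
  · exact h1 a b
  · exact (h1 a b).swap_cols
  · exact (h1 a b).swap_rows
  · exact (h1 a b).swap_rows.swap_cols

theorem IsH2Reducible.numHadamardSubmatrices_trichotomy (h : IsH2Reducible H) :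
    numHadamardSubmatrices H = 9 ∨ numHadamardSubmatrices H = 17 ∨
      18 < numHadamardSubmatrices H := by
  obtain ⟨hH, K, hK, hb⟩ := h
  have h1 := (isBlocked_of_submatrix (hK.isInverseOrthogonal hH.isInverseOrthogonal)
    hb).totalCount_trichotomy
  rw [hK.totalCount_eq, ← hH.four_mul_numHadamardSubmatrices] at h1
  omega

end Hadamard

/-! ### Exact arithmetic and matrices attaining 9 and 17 -/

section Examples

/-- The integers `(a, b, c, d)` stand for `a + b √p + c √q + d √(p q)`. -/
abbrev Biquad : Type := ℤ × ℤ × ℤ × ℤ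

namespace Biquad

/-- The sum of two elements. -/
def plus (x y : Biquad) : Biquad :=
  (x.1 + y.1, x.2.1 + y.2.1, x.2.2.1 + y.2.2.1, x.2.2.2 + y.2.2.2)

/-- The opposite of an element. -/
def opp (x : Biquad) : Biquad := (-x.1, -x.2.1, -x.2.2.1, -x.2.2.2)

/-- The product of two elements. -/
def times (p q : ℤ) (x y : Biquad) : Biquad :=
  (x.1 * y.1 + p * (x.2.1 * y.2.1) + q * (x.2.2.1 * y.2.2.1) + p * q * (x.2.2.2 * y.2.2.2),
    x.1 * y.2.1 + x.2.1 * y.1 + q * (x.2.2.1 * y.2.2.2 + x.2.2.2 * y.2.2.1),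
    x.1 * y.2.2.1 + x.2.2.1 * y.1 + p * (x.2.1 * y.2.2.2 + x.2.2.2 * y.2.1),
    x.1 * y.2.2.2 + x.2.2.2 * y.1 + x.2.1 * y.2.2.1 + x.2.2.1 * y.2.1)

/-- The rational part of the norm down to `ℚ(√p)`. -/
def relNormFst (p q : ℤ) (x : Biquad) : ℤ :=
  x.1 ^ 2 + p * x.2.1 ^ 2 - q * (x.2.2.1 ^ 2 + p * x.2.2.2 ^ 2)

/-- The coefficient of `√p` in the norm down to `ℚ(√p)`. -/
def relNormSnd (q : ℤ) (x : Biquad) : ℤ :=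
  2 * (x.1 * x.2.1 - q * (x.2.2.1 * x.2.2.2))

/-- The norm down to `ℚ`. -/
def absNorm (p q : ℤ) (x : Biquad) : ℤ :=
  relNormFst p q x ^ 2 - p * relNormSnd q x ^ 2

/-- The real number represented by an element, given the two square roots. -/
def eval (s t : ℝ) (x : Biquad) : ℝ := x.1 + x.2.1 * s + x.2.2.1 * t + x.2.2.2 * (s * t)

variable {p q : ℤ} {s t : ℝ} {x y : Biquad}

theorem eval_plus : eval s t (plus x y) = eval s t x + eval s t y := by
  simp only [eval, plus]
  push_cast
  ring

theorem eval_opp : eval s t (opp x) = - eval s t x := by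
  simp only [eval, opp]
  push_cast
  ring

theorem eval_times (hs : s ^ 2 = p) (ht : t ^ 2 = q) :
    eval s t (times p q x y) = eval s t x * eval s t y := by
  simp only [eval, times]
  push_cast
  rw [← hs, ← ht]
  ring

/-- The norm is a multiple of the value. Only this direction is needed, so no independence of the
square roots over ℚ is required. -/
theorem eval_ne_zero (hs : s ^ 2 = p) (ht : t ^ 2 = q) (h : absNorm p q x ≠ 0) :
    eval s t x ≠ 0 := by
  intro h0
  have h1 : (absNorm p q x : ℝ) = eval s t x * ((x.1 + x.2.1 * s - x.2.2.1 * t - x.2.2.2 * (s * t)) *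
      (relNormFst p q x - relNormSnd q x * s)) := by
    simp only [absNorm, relNormFst, relNormSnd, eval]
    push_cast
    rw [← hs, ← ht]
    ring
  rw [h0, zero_mul] at h1
  exact h (by exact_mod_cast h1)

end Biquad

namespace GaussBiquad

open Biquad

/-- The complex number represented by a pair. -/
noncomputable def eval (s t : ℝ) (z : Biquad × Biquad) : ℂ :=
  ⟨Biquad.eval s t z.1, Biquad.eval s t z.2⟩

/-- The sum of two elements. -/
def plus (z w : Biquad × Biquad) : Biquad × Biquad := (Biquad.plus z.1 w.1, Biquad.plus z.2 w.2)

/-- The product of two elements. -/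
def times (p q : ℤ) (z w : Biquad × Biquad) : Biquad × Biquad :=
  (Biquad.plus (Biquad.times p q z.1 w.1) (opp (Biquad.times p q z.2 w.2)),
    Biquad.plus (Biquad.times p q z.1 w.2) (Biquad.times p q z.2 w.1))

/-- The complex conjugate of an element. -/
def conj (z : Biquad × Biquad) : Biquad × Biquad := (z.1, opp z.2)

/-- An integer as an element. -/
def ofInt (n : ℤ) : Biquad × Biquad := ((n, 0, 0, 0), (0, 0, 0, 0))

/-- The squared absolute value of an element. -/
def normSq (p q : ℤ) (z : Biquad × Biquad) : Biquad :=
  Biquad.plus (Biquad.times p q z.1 z.1) (Biquad.times p q z.2 z.2)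

/-- The permanent of the submatrix in rows `i`, `j` and columns `k`, `l`. -/
def perm (p q : ℤ) (A : Fin 6 → Fin 6 → Biquad × Biquad) (i j k l : Fin 6) : Biquad × Biquad :=
  plus (times p q (A i k) (A j l)) (times p q (A i l) (A j k))

/-- The Hermitian inner product of the rows `i` and `j`. -/
def rowInner (p q : ℤ) (A : Fin 6 → Fin 6 → Biquad × Biquad) (i j : Fin 6) : Biquad × Biquad :=
  plus (plus (plus (plus (plus (times p q (A i 0) (conj (A j 0))) (times p q (A i 1) (conj (A j 1))))
    (times p q (A i 2) (conj (A j 2)))) (times p q (A i 3) (conj (A j 3))))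
    (times p q (A i 4) (conj (A j 4)))) (times p q (A i 5) (conj (A j 5)))

variable {p q : ℤ} {s t : ℝ} {z w : Biquad × Biquad}

theorem eval_plus : eval s t (plus z w) = eval s t z + eval s t w := by
  simp only [eval, plus, Biquad.eval_plus]
  rfl

theorem eval_times (hs : s ^ 2 = p) (ht : t ^ 2 = q) :
    eval s t (times p q z w) = eval s t z * eval s t w := by
  apply Complex.ext
  · simp only [eval, times, Biquad.eval_plus, Biquad.eval_opp, Biquad.eval_times hs ht,
      Complex.mul_re]
    ring
  · simp only [eval, times, Biquad.eval_plus, Biquad.eval_opp, Biquad.eval_times hs ht,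
      Complex.mul_im]

theorem eval_conj : eval s t (conj z) = star (eval s t z) := by
  apply Complex.ext <;> simp [eval, conj, Biquad.eval_opp]

theorem eval_ofInt (n : ℤ) : eval s t (ofInt n) = n := by
  apply Complex.ext <;> simp [eval, ofInt, Biquad.eval]

theorem eval_ne_zero (hs : s ^ 2 = p) (ht : t ^ 2 = q) (h : absNorm p q (normSq p q z) ≠ 0) :
    eval s t z ≠ 0 := by
  intro h0
  apply Biquad.eval_ne_zero hs ht h
  have h1 := congrArg Complex.re h0
  have h2 := congrArg Complex.im h0
  simp only [eval, Complex.zero_re, Complex.zero_im] at h1 h2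
  simp [normSq, Biquad.eval_plus, Biquad.eval_times hs ht, h1, h2]

/-- A table of integers representing a matrix with the asserted number of Hadamard submatrices. -/
theorem exists_isH2Reducible {A : Fin 6 → Fin 6 → Biquad × Biquad} {d : ℤ} {N : ℕ} (hp : 0 ≤ p)
    (hq : 0 ≤ q) (hd : d ≠ 0)
    (hunit : ∀ i j, times p q (A i j) (conj (A i j)) = ofInt (d ^ 2))
    (hrow : ∀ i j, rowInner p q A i j = ofInt (if i = j then 6 * d ^ 2 else 0))
    (hblock : ∀ a b, perm p q A (pairIndex a 0) (pairIndex a 1) (pairIndex b 0) (pairIndex b 1) =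
      ofInt 0)
    (hperm : ∀ i j k l, perm p q A i j k l = ofInt 0 ∨
      absNorm p q (normSq p q (perm p q A i j k l)) ≠ 0)
    (hN : (Finset.univ.filter fun r : (Fin 6 × Fin 6) × (Fin 6 × Fin 6) =>
      r.1.1 < r.1.2 ∧ r.2.1 < r.2.2 ∧ perm p q A r.1.1 r.1.2 r.2.1 r.2.2 = ofInt 0).card = N) :
    ∃ H : Matrix (Fin 6) (Fin 6) ℂ, IsH2Reducible H ∧ numHadamardSubmatrices H = N := by
  have hs : √(p : ℝ) ^ 2 = p := Real.sq_sqrt (by exact_mod_cast hp)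
  have ht : √(q : ℝ) ^ 2 = q := Real.sq_sqrt (by exact_mod_cast hq)
  have hd' : (d : ℂ) ≠ 0 := by exact_mod_cast hd
  obtain ⟨e, he⟩ : ∃ e, e = eval √(p : ℝ) √(q : ℝ) := ⟨_, rfl⟩
  obtain ⟨H, hH⟩ : ∃ H : Matrix (Fin 6) (Fin 6) ℂ, ∀ i j, H i j = e (A i j) / d :=
    ⟨fun i j => e (A i j) / d, fun _ _ => rfl⟩
  have emul : ∀ z w, e (times p q z w) = e z * e w := fun z w => by rw [he, eval_times hs ht]
  have eadd : ∀ z w, e (plus z w) = e z + e w := fun z w => by rw [he, eval_plus]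
  have econj : ∀ z, e (conj z) = star (e z) := fun z => by rw [he, eval_conj]
  have eint : ∀ n : ℤ, e (ofInt n) = n := fun n => by rw [he, eval_ofInt]
  have sd : star (d : ℂ) = d := by simp
  have hmem : ∀ i j, H i j ∈ unitary ℂ := fun i j => by
    have h1 : e (A i j) * star (e (A i j)) = d ^ 2 := by
      rw [← econj, ← emul, hunit, eint]
      push_cast
      rfl
    have h2 : H i j * star (H i j) = 1 := by
      rw [hH, star_div₀, sd]
      rw [div_mul_div_comm, h1, sq, div_self (mul_ne_zero hd' hd')]
    exact Unitary.mem_iff.2 ⟨by rw [mul_comm]; exact h2, h2⟩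
  have hHad : H.IsHadamard := by
    refine Matrix.IsHadamard.of_mul_conjTranspose hmem ?_ ?_
    · ext i j
      have h1 := congrArg e (hrow i j)
      simp only [rowInner, eadd, emul, econj, eint] at h1
      have h2 : (H * H.conjTranspose) i j = (e (A i 0) * star (e (A j 0)) +
          e (A i 1) * star (e (A j 1)) + e (A i 2) * star (e (A j 2)) +
          e (A i 3) * star (e (A j 3)) + e (A i 4) * star (e (A j 4)) +
          e (A i 5) * star (e (A j 5))) / d ^ 2 := by
        simp only [Matrix.mul_apply, Matrix.conjTranspose_apply, hH, Fin.sum_univ_six, star_div₀, sd]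
        field_simp
      rw [h2, h1]
      by_cases hij : i = j
      · simp [hij, hd']
      · simp [hij]
    · exact (isUnit_iff_ne_zero.2 (by simp)).isRegular
  -- Each permanent is formally zero or has nonzero norm, so the integer count is exact.
  have hanti : ∀ i j k l, Antipodal H i j k l ↔ perm p q A i j k l = ofInt 0 := fun i j k l => by
    have h1 : H i k * H j l + H i l * H j k = e (perm p q A i j k l) / d ^ 2 := by
      simp only [perm, eadd, emul, hH]
      field_simp
    unfold Antipodal
    rw [h1]
    constructor
    · intro h2
      refine (hperm i j k l).resolve_right fun h3 => ?_
      have := eval_ne_zero hs ht h3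
      rw [← he] at this
      simp [this, hd'] at h2
    · intro h2
      rw [h2, eint]
      simp
  refine ⟨H, ⟨hHad, H, ⟨1, 1, 1, 1, by simp, by simp, by simp⟩, fun a b => ?_⟩, ?_⟩
  · exact (isHadamard_two_iff fun _ _ => hmem _ _).2 ((hanti _ _ _ _).2 (hblock a b))
  · rw [← hN, numHadamardSubmatrices]
    congr 1
    ext r
    simp only [Finset.mem_filter, hHad.submatrix_iff, hanti]

end GaussBiquad

/-- Numerators, over the denominator `1620970`, of a matrix with exactly nine submatrices. -/
def tableNine : Fin 6 → Fin 6 → Biquad × Biquad :=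
  ![![((1620970, 0, 0, 0), (0, 0, 0, 0)),
      ((1620970, 0, 0, 0), (0, 0, 0, 0)),
      ((1620970, 0, 0, 0), (0, 0, 0, 0)),
      ((1620970, 0, 0, 0), (0, 0, 0, 0)),
      ((1620970, 0, 0, 0), (0, 0, 0, 0)),
      ((1620970, 0, 0, 0), (0, 0, 0, 0))],
    ![((1620970, 0, 0, 0), (0, 0, 0, 0)),
      ((-1620970, 0, 0, 0), (0, 0, 0, 0)),
      ((0, -40440, 0, 0), (0, 0, 0, 3370)),
      ((0, 40440, 0, 0), (0, 0, 0, -3370)),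
      ((0, -40440, 0, 0), (0, 0, 0, -3370)),
      ((0, 40440, 0, 0), (0, 0, 0, 3370))],
    ![((1620970, 0, 0, 0), (0, 0, 0, 0)),
      ((0, 0, -80808, 0), (0, 0, 35594, 0)),
      ((-486291, 41114, 37518, 1273), (-162097, -22242, 41366, 21)),
      ((-486291, -41114, 37518, -1273), (-162097, 22242, 41366, -21)),
      ((-324194, 49539, 2886, 409), (162097, -2022, -59163, -802)),
      ((-324194, -49539, 2886, -409), (162097, 2022, -59163, 802))],
    ![((1620970, 0, 0, 0), (0, 0, 0, 0)),
      ((0, 0, 80808, 0), (0, 0, -35594, 0)),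
      ((-324194, 21231, -20683, -2538), (972582, -9773, 18759, -206)),
      ((-324194, -21231, -20683, 2538), (972582, 9773, 18759, 206)),
      ((-486291, 12806, -19721, -2514), (-972582, 10447, -962, 987)),
      ((-486291, -12806, -19721, 2514), (-972582, -10447, -962, -987))],
    ![((1620970, 0, 0, 0), (0, 0, 0, 0)),
      ((0, 0, 11544, 0), (0, 0, 87542, 0)),
      ((162097, -38418, -33189, -154), (-324194, 31341, -49062, -887)),
      ((162097, 38418, -33189, 154), (-324194, -31341, -49062, 887)),
      ((-972582, 20557, 27417, 1358), (324194, 11121, 5291, 2154)),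
      ((-972582, -20557, 27417, -1358), (324194, -11121, 5291, -2154))],
    ![((1620970, 0, 0, 0), (0, 0, 0, 0)),
      ((0, 0, -11544, 0), (0, 0, -87542, 0)),
      ((-972582, 16513, 16354, 1419), (-486291, 674, -11063, -2298)),
      ((-972582, -16513, 16354, -1419), (-486291, -674, -11063, 2298)),
      ((162097, -42462, -10582, 747), (486291, -19546, 54834, 1031)),
      ((162097, 42462, -10582, -747), (486291, 19546, 54834, -1031))]]

/-- Numerators, over the denominator `10`, of a matrix with exactly seventeen submatrices. -/
def tableSeventeen : Fin 6 → Fin 6 → Biquad × Biquad :=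
  ![![((10, 0, 0, 0), (0, 0, 0, 0)),
      ((10, 0, 0, 0), (0, 0, 0, 0)),
      ((10, 0, 0, 0), (0, 0, 0, 0)),
      ((10, 0, 0, 0), (0, 0, 0, 0)),
      ((10, 0, 0, 0), (0, 0, 0, 0)),
      ((10, 0, 0, 0), (0, 0, 0, 0))],
    ![((10, 0, 0, 0), (0, 0, 0, 0)),
      ((-10, 0, 0, 0), (0, 0, 0, 0)),
      ((10, 0, 0, 0), (0, 0, 0, 0)),
      ((-10, 0, 0, 0), (0, 0, 0, 0)),
      ((0, 0, 0, 0), (-10, 0, 0, 0)),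
      ((0, 0, 0, 0), (10, 0, 0, 0))],
    ![((10, 0, 0, 0), (0, 0, 0, 0)),
      ((2, 3, 0, 0), (6, -1, 0, 0)),
      ((-2, 0, 0, 0), (0, -4, 0, 0)),
      ((2, -3, 0, 0), (-6, -1, 0, 0)),
      ((-6, 1, 0, 0), (2, 3, 0, 0)),
      ((-6, -1, 0, 0), (-2, 3, 0, 0))],
    ![((10, 0, 0, 0), (0, 0, 0, 0)),
      ((-2, -3, 0, 0), (-6, 1, 0, 0)),
      ((-8, 0, 0, 0), (6, 0, 0, 0)),
      ((-2, 3, 0, 0), (-6, -1, 0, 0)),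
      ((-8, 0, 0, 0), (6, 0, 0, 0)),
      ((10, 0, 0, 0), (0, 0, 0, 0))],
    ![((10, 0, 0, 0), (0, 0, 0, 0)),
      ((-2, -3, 0, 0), (6, -1, 0, 0)),
      ((-8, 0, 0, 0), (-6, 0, 0, 0)),
      ((-2, 3, 0, 0), (6, 1, 0, 0)),
      ((10, 0, 0, 0), (0, 0, 0, 0)),
      ((-8, 0, 0, 0), (-6, 0, 0, 0))],
    ![((10, 0, 0, 0), (0, 0, 0, 0)),
      ((2, 3, 0, 0), (-6, 1, 0, 0)),
      ((-2, 0, 0, 0), (0, 4, 0, 0)),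
      ((2, -3, 0, 0), (6, 1, 0, 0)),
      ((-6, -1, 0, 0), (2, -3, 0, 0)),
      ((-6, 1, 0, 0), (-2, -3, 0, 0))]]

set_option maxRecDepth 10000 in
theorem exists_numHadamardSubmatrices_eq_nine :
    ∃ H : Matrix (Fin 6) (Fin 6) ℂ, IsH2Reducible H ∧ numHadamardSubmatrices H = 9 :=
  -- The denominator is 10pq. Beyond its first two entries, the second row is ±(12 ± i√337)/√481,
  -- unimodular as 12² + 337 = 481.
  GaussBiquad.exists_isH2Reducible (p := 481) (q := 337) (A := tableNine) (d := 1620970)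
    (by decide) (by decide) (by decide) (by decide +kernel) (by decide +kernel) (by decide +kernel)
    (by decide +kernel) (by decide +kernel)

set_option maxRecDepth 10000 in
theorem exists_numHadamardSubmatrices_eq_seventeen :
    ∃ H : Matrix (Fin 6) (Fin 6) ℂ, IsH2Reducible H ∧ numHadamardSubmatrices H = 17 :=
  -- Only √6 occurs in the table, so the value of `q` is immaterial. The first two rows have
  -- quotients 1, -1, each twice, and ±i, hence five submatrices.
  GaussBiquad.exists_isH2Reducible (p := 6) (q := 2) (A := tableSeventeen) (d := 10)
    (by decide) (by decide) (by decide) (by decide +kernel) (by decide +kernel) (by decide +kernel)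
    (by decide +kernel) (by decide +kernel)

end Examples

theorem mainTheorem2 :
    (∀ H : Matrix (Fin 6) (Fin 6) ℂ, IsH2Reducible H →
      numHadamardSubmatrices H = 9 ∨ numHadamardSubmatrices H = 17 ∨
        18 < numHadamardSubmatrices H) ∧
    (∃ H : Matrix (Fin 6) (Fin 6) ℂ, IsH2Reducible H ∧ numHadamardSubmatrices H = 9) ∧
    (∃ H : Matrix (Fin 6) (Fin 6) ℂ, IsH2Reducible H ∧ numHadamardSubmatrices H = 17) :=
  ⟨fun _ h => h.numHadamardSubmatrices_trichotomy, exists_numHadamardSubmatrices_eq_nine,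
    exists_numHadamardSubmatrices_eq_seventeen⟩
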